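/- Let $l,k\ge 0$ be integers, $n=l+2k$, and let $\alpha,\delta\in\mathbb R^l$, $\zeta\in\mathbb R^k$, $b,e\in\mathbb R^n$, $c\in\mathbb R$. Write $E=\begin{pmatrix}0&1\\1&0\end{pmatrix}$, $J(\zeta_j,2)=\begin{pmatrix}\zeta_j&1\\0&\zeta_j\end{pmatrix}$ and $$A=\mathrm{diag}(\alpha_1,\dots,\alpha_l,\underbrace{E,\dots,E}_{k}),\qquad D=\mathrm{diag}(\delta_1,\dots,\delta_l,E\,J(\zeta_1,2),\dots,E\,J(\zeta_k,2)).$$ Assume $b_i=0$ for $i=l+1,\dots,n$ and $e_{l+2j-1}=0$ for $j=1,\dots,k$. Consider the problem $$(\mathrm{EP})\qquad \inf\ f(x)=\tfrac12x^TDx+e^Tx\quad\text{subject to}\quad h(x)=\tfrac12x^TAx+b^Tx+c=0,\quad x\in\mathbb R^n,$$ and assume that (i) (EP) is feasible; (ii) the conditions $A\succeq0$, $b\in\mathrm{Range}(A)$ and $c=\frac12b^TA^+b$ do not all hold, where $A^+$ is the Moore–Penrose pseudoinverse; (iii) $A\ne0$. Let $c_0=-\sum_{j=1}^k\frac12e_{l+2j}^2$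 and consider the second order cone program $$(\mathrm{EP}_1)\qquad\begin{aligned}\inf\ &\sum_{i=1}^l(\delta_iy_i+e_ix_i)+\sum_{j=1}^k\zeta_jz_j+c_0\\ \text{s.t. }&\sum_{i=1}^l(\alpha_iy_i+b_ix_i)+\sum_{j=1}^kz_j+c=0,\\ &\tfrac12x_i^2-y_i\le0,\quad i=1,\dots,l,\qquad x,y\in\mathbb R^l,\ z\in\mathbb R^k.\end{aligned}$$ Let $v(\cdot)\in[-\infty,\infty)$ denote the infimum of a problem. Then: 1. $v(\mathrm{EP})=v(\mathrm{EP}_1)$. 2. If $(\mathrm{EP}_1)$ has an optimal solution, then it has a tight one, that is, an optimal solution $(\bar x,\bar y,\bar z)$ with $\frac12\bar x_i^2=\bar y_i$ for $i=1,\dots,l$. If (EP) is bounded from below, then $(\mathrm{EP}_1)$ has an optimal solution. 3. Let $(\bar x,\bar y,\bar z)$ be any tight optimal solution of $(\mathrm{EP}_1)$. For $M>0$ let $\tilde x=\tilde x(M)\in\mathbb R^n$ be given by $\tilde x_i=\bar x_i$ for $i\le l$ and, for $j=1,\dots,k$, $$\tilde x_{l+2j}=\begin{cases}1/M&\text{if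 }e_{l+2j}=0\text{ and }\bar z_j\ne0,\\-e_{l+2j}&\text{otherwise,}\end{cases}\qquad \tilde x_{l+2j-1}=\frac{\bar z_j}{\tilde x_{l+2j}},$$ where the last quotient is read as $0$ if $e_{l+2j}=0$ and $\bar z_j=0$. If there is no $j$ with $e_{l+2j}=0$ and $\bar z_j\neq0$, then $\tilde x(M)$ is an optimal solution of (EP) for every $M>0$. In every case, for each $\epsilon>0$ there is $M_0>0$ such that, for all $M\ge M_0$, $\tilde x(M)$ is feasible for (EP) and $f(\tilde x(M))<v(\mathrm{EP})+\epsilon$. 4. If (EP) is bounded from below, then $v(\mathrm{EP})$ is not attained if and only if every tight optimal solution $(\bar x,\bar y,\bar z)$ of $(\mathrm{EP}_1)$ has an index $j$ with $e_{l+2j}=0$ and $\bar z_j\ne0$. 5. If $\zeta_i\ne\zeta_j$ for some $i,j\in\{1,\dots,k\}$, then (EP) is unbounded from below. -/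

import Mathlib

namespace GTRS

open Matrix

/-! ### Optimization problems -/

/-- The optimal value of minimizing `f` over `X`, in the extended reals. -/
noncomputable def optVal {V : Type*} (X : Set V) (f : V → ℝ) : EReal :=
  ⨅ x ∈ X, ((f x : ℝ) : EReal)

/-- `x` is an optimal solution of minimizing `f` over `X`. -/
def IsOptimal {V : Type*} (X : Set V) (f : V → ℝ) (x : V) : Prop :=
  x ∈ X ∧ ∀ x' ∈ X, f x ≤ f x'

/-- The problem of minimizing `f` over `X` is bounded from below. -/
def BoundedFromBelow {V : Type*} (X : Set V) (f : V → ℝ) : Prop :=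
  ∃ m : ℝ, ∀ x ∈ X, m ≤ f x

/-! ### The equality constrained problem for arbitrary data -/

/-- The quadratic function `½ xᵀ Q x + qᵀ x`. -/
noncomputable def quad {ι : Type*} [Fintype ι] (Q : Matrix ι ι ℝ) (q x : ι → ℝ) : ℝ :=
  1 / 2 * (x ⬝ᵥ (Q *ᵥ x)) + q ⬝ᵥ x

/-- The feasible set `{x | ½ xᵀ A x + bᵀ x + c = 0}`. -/
def feasEP {ι : Type*} [Fintype ι] (A : Matrix ι ι ℝ) (b : ι → ℝ) (c : ℝ) : Set (ι → ℝ) :=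
  {x | quad A b x + c = 0}

/-- `P` is the Moore-Penrose pseudoinverse of the real matrix `A` (the four Penrose equations). -/
def IsPseudoinverse {ι : Type*} [Fintype ι] (A P : Matrix ι ι ℝ) : Prop :=
  A * P * A = A ∧ P * A * P = P ∧ (A * P)ᵀ = A * P ∧ (P * A)ᵀ = P * A

/-- The standing assumption on the constraint: it is feasible; it is not the case that at once
`A ⪰ 0`, `b ∈ Range A` and `c = ½ bᵀ A⁺ b`; and `A ≠ 0`. -/
structure ConstraintAssumption {ι : Type*} [Fintype ι]
    (A : Matrix ι ι ℝ) (b : ι → ℝ) (c : ℝ) : Prop where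
  feasible : (feasEP A b c).Nonempty
  nondegenerate : ¬ (A.PosSemidef ∧ (∃ w : ι → ℝ, A *ᵥ w = b) ∧
    ∃ P : Matrix ι ι ℝ, IsPseudoinverse A P ∧ c = 1 / 2 * (b ⬝ᵥ (P *ᵥ b)))
  ne_zero : A ≠ 0

/-! ### The canonical form with blocks of size one and two -/

/-- The coordinates of `ℝⁿ`, where `n = l + 2k`: `inl i` is the `i`-th coordinate (`i ≤ l`),
`inr (0, j)` is the coordinate `l + 2j - 1` and `inr (1, j)` is the coordinate `l + 2j`. -/
abbrev Idx (l k : ℕ) : Type := Fin l ⊕ (Fin 2 × Fin k)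

/-- The `2 × 2` anti-diagonal matrix `E`. -/
def antiE : Matrix (Fin 2) (Fin 2) ℝ := !![0, 1; 1, 0]

/-- The `2 × 2` Jordan block `J(ζ, 2)`. -/
def jordan (ζ : ℝ) : Matrix (Fin 2) (Fin 2) ℝ := !![ζ, 1; 0, ζ]

/-- `A = diag(α₁, …, α_l, E, …, E)`. -/
def canonA {l : ℕ} (k : ℕ) (α : Fin l → ℝ) : Matrix (Idx l k) (Idx l k) ℝ :=
  Matrix.fromBlocks (Matrix.diagonal α) 0 0 (Matrix.blockDiagonal fun _ : Fin k => antiE)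

/-- `D = diag(δ₁, …, δ_l, E J(ζ₁, 2), …, E J(ζ_k, 2))`. -/
def canonD {l k : ℕ} (δ : Fin l → ℝ) (ζ : Fin k → ℝ) : Matrix (Idx l k) (Idx l k) ℝ :=
  Matrix.fromBlocks (Matrix.diagonal δ) 0 0
    (Matrix.blockDiagonal fun j : Fin k => antiE * jordan (ζ j))

/-! ### The second order cone reformulation -/

/-- The space of the variables `(x, y, z) ∈ ℝˡ × ℝˡ × ℝᵏ` of the reformulation. -/
abbrev Var (l k : ℕ) : Type := (Fin l → ℝ) × (Fin l → ℝ) × (Fin k → ℝ)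

/-- The feasible set of the reformulation. -/
def feasEP1 {l k : ℕ} (α : Fin l → ℝ) (b : Idx l k → ℝ) (c : ℝ) : Set (Var l k) :=
  {p | ∑ i, (α i * p.2.1 i + b (Sum.inl i) * p.1 i) + ∑ j, p.2.2 j + c = 0 ∧
    ∀ i, 1 / 2 * p.1 i ^ 2 - p.2.1 i ≤ 0}

/-- The constant `c₀ = - ∑ⱼ ½ e_{l+2j}²`. -/
noncomputable def const0 {l k : ℕ} (e : Idx l k → ℝ) : ℝ :=
  -∑ j : Fin k, 1 / 2 * e (Sum.inr (1, j)) ^ 2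

/-- The objective function of the reformulation. -/
noncomputable def objEP1 {l k : ℕ} (δ : Fin l → ℝ) (ζ : Fin k → ℝ) (e : Idx l k → ℝ)
    (p : Var l k) : ℝ :=
  ∑ i, (δ i * p.2.1 i + e (Sum.inl i) * p.1 i) + ∑ j, ζ j * p.2.2 j + const0 e

/-- `(x̄, ȳ, z̄)` is an optimal solution of the reformulation with `½ x̄ᵢ² = ȳᵢ` for all `i`. -/
def IsTightOptimal {l k : ℕ} (α δ : Fin l → ℝ) (ζ : Fin k → ℝ) (b e : Idx l k → ℝ) (c : ℝ)
    (p : Var l k) : Prop :=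
  IsOptimal (feasEP1 α b c) (objEP1 δ ζ e) p ∧ ∀ i, 1 / 2 * p.1 i ^ 2 = p.2.1 i

open Classical in
/-- The coordinate `x̃_{l+2j}` in terms of `e_{l+2j}`, `z̄ⱼ` and the parameter `M`. -/
noncomputable def recoverSnd (ej zj M : ℝ) : ℝ :=
  if ej = 0 ∧ zj ≠ 0 then 1 / M else -ej

/-- The vector `x̃` built from `(x̄, ȳ, z̄)` and `M`. The quotient `z̄ⱼ / x̃_{l+2j}` has a zero
denominator only if `e_{l+2j} = 0` and `z̄ⱼ = 0`; then it is `0`. -/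
noncomputable def recover {l k : ℕ} (e : Idx l k → ℝ) (p : Var l k) (M : ℝ) : Idx l k → ℝ :=
  Sum.elim p.1 fun rj =>
    if rj.1 = 0 then p.2.2 rj.2 / recoverSnd (e (Sum.inr (1, rj.2))) (p.2.2 rj.2) M
    else recoverSnd (e (Sum.inr (1, rj.2))) (p.2.2 rj.2) M

end GTRS

open GTRS

namespace GTRS

open Filter Topology

/-! Everything rests on one identity. Put `z_j = x_{l+2j-1} x_{l+2j}` and `y_i = x_i²/2`. Since `b`
vanishes on the blocks and `e_{l+2j-1} = 0`, completing the square in `x_{l+2j}` gives `f(x) =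
objEP1 (liftVar x) + ∑ ½ (x_{l+2j} + e_{l+2j})²`, and feasibility is preserved
(`quad_canonD_eq_objEP1`, `liftVar_mem_feasEP1`). So the reformulation is a relaxation. Conversely a
tight point comes from `x` with zero gap by taking `x_{l+2j} = -e_{l+2j}`, unless `e_{l+2j} = 0` and
`z_j ≠ 0`; then `x_{l+2j} = 1/M` makes the gap arbitrarily small. This exception is exactly what
prevents attainment.

Tightness: a point inside a parabola slides along a level line of the constraint, in the direction
that does not increase the objective, until it meets the parabola (`exists_tight_coord`). This fails
only if `α_i = 0`, `b_i ≠ 0`, `δ_i < 0`. In that case, as `A ≠ 0`, another variable or a block makes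
`x_i` quadratic in a parameter `s`, and the objective tends to `-∞` like `-s⁴`.

Attainment: if `k > 0`, boundedness forces all `ζ_j` to be equal, `∑ z_j` is eliminated, and an
unconstrained separable problem remains. If `k = 0`, a Lagrange multiplier leaves a separable form
that is coercive in some coordinates and zero in the others; the latter serve only to restore the
constraint (`exists_min_of_bddBelow`). -/

/-- A point above the parabola `y = ½ x²` can be moved onto it along a line of constant
`α y + b x` without increasing `δ y + e x`. -/
theorem exists_tight_coord {α b δ : ℝ} (e : ℝ) {x y : ℝ} (hxy : 1 / 2 * x ^ 2 - y ≤ 0)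
    (hgood : ¬ (α = 0 ∧ b ≠ 0 ∧ δ < 0)) :
    ∃ x' y' : ℝ, 1 / 2 * x' ^ 2 = y' ∧ α * y' + b * x' = α * y + b * x ∧
      δ * y' + e * x' ≤ δ * y + e * x := by
  -- The direction `(1, κ)` preserves the constraint. The displacements `-(x - κ) ± R` are the roots
  -- of `½ (x + t)² = y + κ t`; they have opposite signs (or vanish), so the sign of `δ κ + e`
  -- selects one.
  have slide : ∀ κ : ℝ, α * κ + b = 0 → ∃ x' y' : ℝ, 1 / 2 * x' ^ 2 = y' ∧
      α * y' + b * x' = α * y + b * x ∧ δ * y' + e * x' ≤ δ * y + e * x := by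
    intro κ hκ
    have hD : 0 ≤ (x - κ) ^ 2 + 2 * (y - 1 / 2 * x ^ 2) := by nlinarith [sq_nonneg (x - κ)]
    set R := Real.sqrt ((x - κ) ^ 2 + 2 * (y - 1 / 2 * x ^ 2)) with hR
    have hRsq : R ^ 2 = (x - κ) ^ 2 + 2 * (y - 1 / 2 * x ^ 2) := Real.sq_sqrt hD
    have hRabs : |x - κ| ≤ R := Real.abs_le_sqrt (by linarith)
    obtain ⟨h1, h2⟩ := abs_le.mp hRabs
    rcases le_total (δ * κ + e) 0 with hs | hs
    · refine ⟨x + (-(x - κ) + R), y + κ * (-(x - κ) + R), ?_, ?_, ?_⟩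
      · linear_combination (1 / 2) * hRsq
      · linear_combination (-(x - κ) + R) * hκ
      · nlinarith [mul_nonneg (neg_nonneg.mpr hs) (show 0 ≤ -(x - κ) + R by linarith)]
    · refine ⟨x + (-(x - κ) - R), y + κ * (-(x - κ) - R), ?_, ?_, ?_⟩
      · linear_combination (1 / 2) * hRsq
      · linear_combination (-(x - κ) - R) * hκ
      · nlinarith [mul_nonneg hs (show 0 ≤ -(-(x - κ) - R) by linarith)]
  by_cases hα : α = 0
  · by_cases hb : b = 0
    · exact slide 0 (by simp [hb])
    -- Here the level line is vertical, so the only move is to lower `y` onto the parabola.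
    · have hδ : 0 ≤ δ := not_lt.mp fun h => hgood ⟨hα, hb, h⟩
      refine ⟨x, 1 / 2 * x ^ 2, rfl, by simp [hα], ?_⟩
      nlinarith [mul_nonneg hδ (show 0 ≤ y - 1 / 2 * x ^ 2 by linarith)]
  · exact slide (-b / α) (by field_simp; ring)

/-- The coefficient of `s⁴` is `½ δ a² < 0`. Substituting `s = 1/τ` and multiplying by `τ⁴` isolates
it as the value at `τ = 0`. -/
theorem quartic_not_bddBelow {δ a : ℝ} (hδ : δ < 0) (ha : a ≠ 0) (β γ e q r C B : ℝ) :
    ¬ ∀ s : ℝ, B ≤ 1 / 2 * δ * (a * s ^ 2 + β * s + γ) ^ 2 + e * (a * s ^ 2 + β * s + γ)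
      + q * s ^ 2 + r * s + C := by
  intro h
  let φ : ℝ → ℝ := fun τ => 1 / 2 * δ * (a + β * τ + γ * τ ^ 2) ^ 2
    + e * τ ^ 2 * (a + β * τ + γ * τ ^ 2) + q * τ ^ 2 + r * τ ^ 3 + (C - B) * τ ^ 4
  have hφ : Continuous φ := by fun_prop
  have hlim : Tendsto φ (𝓝[≠] 0) (𝓝 (φ 0)) := hφ.continuousAt.mono_left nhdsWithin_le_nhds
  have hnn : 0 ≤ φ 0 := by
    refine ge_of_tendsto hlim ?_
    filter_upwards [self_mem_nhdsWithin] with τ hτ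
    have hτ' : τ ≠ 0 := hτ
    have h1 := mul_nonneg (sub_nonneg.mpr (h τ⁻¹)) (show 0 ≤ τ ^ 4 by positivity)
    refine h1.trans_eq ?_
    simp only [φ]
    field_simp
    ring
  have h0 : φ 0 = 1 / 2 * δ * a ^ 2 := by simp [φ]
  rw [h0] at hnn
  have : 0 < a ^ 2 := by positivity
  nlinarith

/-! ### Linear forms over products of epigraphs of `½ x²` -/

section Separable

variable {ι : Type*}

/-- The product of the epigraphs `yᵢ ≥ ½ xᵢ²`. -/
def AboveParabola (x y : ι → ℝ) : Prop := ∀ i, 1 / 2 * x i ^ 2 - y i ≤ 0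

theorem aboveParabola_single [DecidableEq ι] (i : ι) {s t : ℝ} (h : 1 / 2 * s ^ 2 - t ≤ 0) :
    AboveParabola (Pi.single i s : ι → ℝ) (Pi.single i t) := by
  intro j
  by_cases hj : j = i
  · subst hj
    simpa using h
  · simp [hj]

theorem AboveParabola.update [DecidableEq ι] {x y : ι → ℝ} (h : AboveParabola x y) (i : ι)
    {s t : ℝ} (hst : 1 / 2 * s ^ 2 - t ≤ 0) :
    AboveParabola (Function.update x i s) (Function.update y i t) := by
  intro j
  by_cases hj : j = i
  · subst hj
    simpa using hst
  · simpa [hj] using h j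

variable [Fintype ι]

/-- The linear form `∑ᵢ (dᵢ yᵢ + gᵢ xᵢ)`. -/
def linForm (d g x y : ι → ℝ) : ℝ := ∑ i, (d i * y i + g i * x i)

theorem linForm_single [DecidableEq ι] (d g : ι → ℝ) (i : ι) (s t : ℝ) :
    linForm d g (Pi.single i s) (Pi.single i t) = d i * t + g i * s := by
  unfold linForm
  rw [Finset.sum_eq_single i]
  · simp
  · intro j _ hj
    simp [hj]
  · simp

theorem linForm_add_smul (δ e α b x y : ι → ℝ) (μ : ℝ) :
    linForm (fun i => δ i + μ * α i) (fun i => e i + μ * b i) x y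
      = linForm δ e x y + μ * linForm α b x y := by
  simp only [linForm, Finset.mul_sum, ← Finset.sum_add_distrib]
  exact Finset.sum_congr rfl fun i _ => by ring

theorem linForm_update [DecidableEq ι] (d g x y : ι → ℝ) (i : ι) (s t : ℝ) :
    linForm d g (Function.update x i s) (Function.update y i t)
      = linForm d g x y + (d i * t + g i * s) - (d i * y i + g i * x i) := by
  unfold linForm
  rw [← Finset.add_sum_erase _ _ (Finset.mem_univ i),
    ← Finset.add_sum_erase _ (fun i => d i * y i + g i * x i) (Finset.mem_univ i)]
  have : ∑ j ∈ Finset.univ.erase i, (d j * Function.update y i t j + g j * Function.update x i s j)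
      = ∑ j ∈ Finset.univ.erase i, (d j * y j + g j * x j) :=
    Finset.sum_congr rfl fun j hj => by simp [Finset.ne_of_mem_erase hj]
  rw [this]
  simp
  ring

/-- A linear form that is bounded below over the product of epigraphs has nonnegative
curvature in every coordinate, and it vanishes in the coordinates without curvature. -/
theorem coeff_of_bddBelow {d g : ι → ℝ} {B : ℝ}
    (h : ∀ x y, AboveParabola x y → B ≤ linForm d g x y) (i : ι) :
    0 < d i ∨ (d i = 0 ∧ g i = 0) := by
  classical
  have h1 : ∀ s t : ℝ, 1 / 2 * s ^ 2 - t ≤ 0 → B ≤ d i * t + g i * s := fun s t hst => by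
    simpa [linForm_single] using h _ _ (aboveParabola_single i hst)
  rcases lt_trichotomy (d i) 0 with hd | hd | hd
  · exfalso
    have ht : 0 ≤ (|B| + 1) / (-d i) := div_nonneg (by positivity) (by linarith)
    have h2 := h1 0 ((|B| + 1) / (-d i)) (by simpa using ht)
    have h3 : d i * ((|B| + 1) / (-d i)) = -(|B| + 1) := by
      rw [div_neg, mul_neg, mul_div_cancel₀ _ hd.ne]
    linarith [neg_abs_le B]
  · refine Or.inr ⟨hd, ?_⟩
    by_contra hg
    have h2 := h1 ((B - 1) / g i) _ (sub_self _).le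
    rw [hd, mul_div_cancel₀ _ hg] at h2
    linarith
  · exact Or.inl hd

/-- Completing the square puts the minimum at the vertex `-g / d`. For `d = g = 0` the quotient is
`0` by convention and both sides vanish. -/
theorem coord_min {d g x y : ℝ} (hd : 0 < d ∨ (d = 0 ∧ g = 0)) (hxy : 1 / 2 * x ^ 2 - y ≤ 0) :
    d * (1 / 2 * (-g / d) ^ 2) + g * (-g / d) ≤ d * y + g * x := by
  rcases hd with hd | ⟨rfl, rfl⟩
  · have h1 : d * (1 / 2 * (-g / d) ^ 2) + g * (-g / d)
        = d * (1 / 2 * x ^ 2) + g * x - d / 2 * (x + g / d) ^ 2 := by field_simp; ring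
    nlinarith [mul_nonneg hd.le (show 0 ≤ y - 1 / 2 * x ^ 2 by linarith),
      mul_nonneg hd.le (sq_nonneg (x + g / d))]
  · simp

theorem exists_min_linForm {d g : ι → ℝ} {B : ℝ}
    (h : ∀ x y, AboveParabola x y → B ≤ linForm d g x y) :
    ∃ x y, AboveParabola x y ∧ ∀ x' y', AboveParabola x' y' → linForm d g x y ≤ linForm d g x' y' :=
  ⟨fun i => -g i / d i, fun i => 1 / 2 * (-g i / d i) ^ 2, fun _ => (sub_self _).le,
    fun _ _ h' => Finset.sum_le_sum fun i _ => coord_min (coeff_of_bddBelow h i) (h' i)⟩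

/-- Half of `d y` dominates `d x² / 4`, which absorbs `g x` at the cost of `g² / d`; the other half
is then bounded by `T + g² / d`. This makes sublevel sets bounded. -/
theorem coord_bound {d g x y T : ℝ} (hd : 0 < d) (hxy : 1 / 2 * x ^ 2 - y ≤ 0)
    (hT : d * y + g * x ≤ T) : y ≤ 2 * (T + g ^ 2 / d) / d := by
  rw [le_div_iff₀ hd]
  have h1 : 0 ≤ d * (1 / 2 * x + g / d) ^ 2 := by positivity
  have h2 : d * (1 / 2 * x + g / d) ^ 2 = d * (1 / 4 * x ^ 2) + g * x + g ^ 2 / d := by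
    field_simp
    ring
  nlinarith [mul_nonneg hd.le (show 0 ≤ y - 1 / 2 * x ^ 2 by linarith)]

/-! ### Multipliers and attainment under one linear equation -/

/-- A Lagrange multiplier for one linear equation over the product of epigraphs, when the
equation's left-hand side takes both signs. -/
theorem exists_multiplier {α b δ e : ι → ℝ} {c B : ℝ}
    (hB : ∀ x y, AboveParabola x y → linForm α b x y + c = 0 → B ≤ linForm δ e x y)
    (hneg : ∃ x y, AboveParabola x y ∧ linForm α b x y + c < 0)
    (hpos : ∃ x y, AboveParabola x y ∧ 0 < linForm α b x y + c) :
    ∃ μ : ℝ, ∀ x y, AboveParabola x y → B ≤ linForm δ e x y + μ * (linForm α b x y + c) := by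
  -- The convex combination with weights proportional to `P` and `N` satisfies the equation, so `hB`
  -- applies to it. Thus every slope bound from the negative side dominates every one from the
  -- positive side, and the infimum `sInf S` separates them.
  have comb : ∀ x y x' y', AboveParabola x y → AboveParabola x' y' →
      linForm α b x y + c < 0 → 0 < linForm α b x' y' + c →
      0 ≤ (linForm δ e x y - B) * (linForm α b x' y' + c)
        + (linForm δ e x' y' - B) * (-(linForm α b x y + c)) := by
    intro x y x' y' h h' hn hp
    set P := linForm α b x' y' + c with hP
    set N := -(linForm α b x y + c) with hN
    have hN0 : 0 < N := by linarith
    have hS : 0 < P + N := by linarith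
    have hlin : ∀ d g : ι → ℝ, linForm d g (fun i => (P * x i + N * x' i) / (P + N))
        (fun i => (P * y i + N * y' i) / (P + N))
        = (P * linForm d g x y + N * linForm d g x' y') / (P + N) := by
      intro d g
      simp only [linForm, Finset.mul_sum, ← Finset.sum_add_distrib, Finset.sum_div]
      exact Finset.sum_congr rfl fun i _ => by ring
    have key := hB (fun i => (P * x i + N * x' i) / (P + N))
      (fun i => (P * y i + N * y' i) / (P + N)) ?_ ?_
    · rw [hlin, le_div_iff₀ hS] at key
      linarith
    · intro i
      have e1 : 1 / 2 * ((P * x i + N * x' i) / (P + N)) ^ 2 - (P * y i + N * y' i) / (P + N)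
          = (P * (1 / 2 * x i ^ 2 - y i) + N * (1 / 2 * x' i ^ 2 - y' i)
            - 1 / 2 * (P * N / (P + N)) * (x i - x' i) ^ 2) / (P + N) := by
        field_simp
        ring
      simp only [e1]
      refine div_nonpos_of_nonpos_of_nonneg ?_ hS.le
      have e2 : 0 ≤ 1 / 2 * (P * N / (P + N)) * (x i - x' i) ^ 2 := by positivity
      nlinarith [mul_nonneg hp.le (neg_nonneg.mpr (h i)), mul_nonneg hN0.le (neg_nonneg.mpr (h' i))]
    · rw [hlin]
      have e1 : linForm α b x y = -N - c := by rw [hN]; ring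
      have e2 : linForm α b x' y' = P - c := by rw [hP]; ring
      rw [e1, e2]
      field_simp
      ring
  let S : Set ℝ := {t | ∃ x y, AboveParabola x y ∧ linForm α b x y + c < 0 ∧
    t = (linForm δ e x y - B) / (-(linForm α b x y + c))}
  have lower : ∀ x' y', AboveParabola x' y' → 0 < linForm α b x' y' + c →
      ∀ t ∈ S, -(linForm δ e x' y' - B) / (linForm α b x' y' + c) ≤ t := by
    rintro x' y' h' hp t ⟨x, y, h, hn, rfl⟩
    rw [div_le_div_iff₀ hp (by linarith)]
    linarith [comb x y x' y' h h' hn hp]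
  have hSne : S.Nonempty := by
    obtain ⟨x, y, h, hn⟩ := hneg
    exact ⟨_, x, y, h, hn, rfl⟩
  have hSbdd : BddBelow S := by
    obtain ⟨x, y, h, hp⟩ := hpos
    exact ⟨_, lower x y h hp⟩
  refine ⟨sInf S, fun x y h => ?_⟩
  rcases lt_trichotomy (linForm α b x y + c) 0 with hs | hs | hs
  · have h1 := csInf_le hSbdd (show _ ∈ S from ⟨x, y, h, hs, rfl⟩)
    rw [le_div_iff₀ (by linarith)] at h1
    linarith
  · rw [hs]
    linarith [hB x y h hs]
  · have h1 := le_csInf hSne (lower x y h hs)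
    rw [div_le_iff₀ hs] at h1
    linarith

/-- Attainment when the constraint function is nonnegative over the product of epigraphs. -/
theorem exists_min_of_nonneg {α b δ e : ι → ℝ} {c B : ℝ}
    (hfeas : ∃ x y, AboveParabola x y ∧ linForm α b x y + c = 0)
    (hB : ∀ x y, AboveParabola x y → linForm α b x y + c = 0 → B ≤ linForm δ e x y)
    (hnn : ∀ x y, AboveParabola x y → 0 ≤ linForm α b x y + c) :
    ∃ x y, (AboveParabola x y ∧ linForm α b x y + c = 0) ∧
      ∀ x' y', AboveParabola x' y' → linForm α b x' y' + c = 0 →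
        linForm δ e x y ≤ linForm δ e x' y' := by
  classical
  obtain ⟨x₀, y₀, h₀, hc₀⟩ := hfeas
  have hα : ∀ i, 0 < α i ∨ (α i = 0 ∧ b i = 0) :=
    coeff_of_bddBelow (B := -c) fun x y h => by linarith [hnn x y h]
  -- Moving one coordinate of a feasible point to its vertex cannot make the constraint function
  -- negative, so a coordinate with `α i ≠ 0` is already at its vertex.
  have forced : ∀ x y, AboveParabola x y → linForm α b x y + c = 0 → ∀ i, α i ≠ 0 →
      x i = -b i / α i ∧ y i = 1 / 2 * (-b i / α i) ^ 2 := by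
    intro x y h hc i hi
    have hpos : 0 < α i := (hα i).resolve_right fun h' => hi h'.1
    have h1 := hnn _ _ (h.update i (s := -b i / α i) (t := 1 / 2 * (-b i / α i) ^ 2)
      (sub_self _).le)
    rw [linForm_update] at h1
    have h2 : α i * (1 / 2 * (-b i / α i) ^ 2) + b i * (-b i / α i)
        = α i * (1 / 2 * x i ^ 2) + b i * x i - α i / 2 * (x i - -b i / α i) ^ 2 := by
      field_simp
      ring
    have h3 : α i / 2 * (x i - -b i / α i) ^ 2 + α i * (y i - 1 / 2 * x i ^ 2) ≤ 0 := by
      linarith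
    have h4 : 0 ≤ α i * (y i - 1 / 2 * x i ^ 2) := mul_nonneg hpos.le (by linarith [h i])
    have h5 : 0 ≤ α i / 2 * (x i - -b i / α i) ^ 2 := by positivity
    have h6 : x i = -b i / α i := by
      have : (x i - -b i / α i) ^ 2 = 0 :=
        (mul_eq_zero.mp (le_antisymm (by linarith) h5)).resolve_left (by positivity)
      linarith [pow_eq_zero_iff (two_ne_zero) |>.mp this]
    have h7 : y i - 1 / 2 * x i ^ 2 = 0 :=
      (mul_eq_zero.mp (le_antisymm (by linarith) h4)).resolve_left hi
    exact ⟨h6, by rw [← h6]; linarith⟩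
  -- Only the coordinates with `α i = 0` are free; there `b i = 0` as well, so they do not enter the
  -- equation and the rest is an unconstrained separable problem.
  let d : ι → ℝ := fun i => if α i = 0 then δ i else 0
  let g : ι → ℝ := fun i => if α i = 0 then e i else 0
  let X : (ι → ℝ) → ι → ℝ := fun x i => if α i = 0 then x i else x₀ i
  let Y : (ι → ℝ) → ι → ℝ := fun y i => if α i = 0 then y i else y₀ i
  have hXY : ∀ x y, AboveParabola x y → AboveParabola (X x) (Y y) ∧
      linForm α b (X x) (Y y) + c = 0 := by
    intro x y h
    refine ⟨fun i => ?_, ?_⟩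
    · by_cases hi : α i = 0
      · simpa [X, Y, hi] using h i
      · simpa [X, Y, hi] using h₀ i
    · rw [← hc₀]
      congr 1
      refine Finset.sum_congr rfl fun i _ => ?_
      by_cases hi : α i = 0
      · have hbi : b i = 0 := by
          rcases hα i with h' | h'
          · exact absurd hi h'.ne'
          · exact h'.2
        simp [hi, hbi]
      · simp [X, Y, hi]
  have hobj : ∀ x y, linForm δ e (X x) (Y y)
      = linForm d g x y + ∑ i, if α i = 0 then 0 else δ i * y₀ i + e i * x₀ i := by
    intro x y
    simp only [linForm, ← Finset.sum_add_distrib]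
    refine Finset.sum_congr rfl fun i _ => ?_
    by_cases hi : α i = 0 <;> simp [X, Y, d, g, hi]
  have hfix : ∀ x y, AboveParabola x y → linForm α b x y + c = 0 → X x = x ∧ Y y = y := by
    intro x y h hc
    constructor <;> funext i <;> by_cases hi : α i = 0
    · simp [X, hi]
    · simp [X, hi, (forced x y h hc i hi).1, (forced x₀ y₀ h₀ hc₀ i hi).1]
    · simp [Y, hi]
    · simp [Y, hi, (forced x y h hc i hi).2, (forced x₀ y₀ h₀ hc₀ i hi).2]
  obtain ⟨x, y, h, hmin⟩ := exists_min_linForm (d := d) (g := g)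
    (B := B - ∑ i, if α i = 0 then 0 else δ i * y₀ i + e i * x₀ i) fun x y h => by
      have := hB _ _ (hXY x y h).1 (hXY x y h).2
      rw [hobj] at this
      linarith
  refine ⟨X x, Y y, hXY x y h, fun x' y' h' hc' => ?_⟩
  obtain ⟨e1, e2⟩ := hfix x' y' h' hc'
  have h1 := hobj x y
  have h2 := hobj x' y'
  rw [e1, e2] at h2
  linarith [hmin x' y' h']

/-- The set is the line, a closed half-line or `{0}`. It keeps the relaxed feasible set in
`exists_min_of_bddBelow` closed. -/
theorem isClosed_setOf_sign (p q : Prop) : IsClosed {t : ℝ | (0 < t → p) ∧ (t < 0 → q)} := by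
  by_cases hp : p <;> by_cases hq : q
  · simp [hp, hq]
  · simpa [hp, hq] using isClosed_le (continuous_const (y := (0 : ℝ))) continuous_id
  · simpa [hp, hq] using isClosed_le continuous_id (continuous_const (y := (0 : ℝ)))
  · have : {t : ℝ | (0 < t → p) ∧ (t < 0 → q)} = Set.Iic 0 ∩ Set.Ici 0 := by
      ext t; simp [hp, hq]
    rw [this]
    exact isClosed_Iic.inter isClosed_Ici

/-- The values of `α y + b x` over the epigraph lie on one side of the value at the vertex
`x = -b / α` unless the form has the appropriate sign. -/
theorem pos_of_vertex_lt {α b x y : ℝ} (hxy : 1 / 2 * x ^ 2 - y ≤ 0)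
    (h : α * (1 / 2 * (-b / α) ^ 2) + b * (-b / α) < α * y + b * x) :
    0 < α ∨ (α = 0 ∧ b ≠ 0) := by
  rcases lt_trichotomy α 0 with hα | hα | hα
  · exfalso
    have := coord_min (d := -α) (g := -b) (Or.inl (by linarith)) hxy
    rw [neg_neg, div_neg, ← neg_div] at this
    linarith
  · refine Or.inr ⟨hα, ?_⟩
    rintro rfl
    simp [hα] at h
  · exact Or.inl hα

theorem neg_of_lt_vertex {α b x y : ℝ} (hxy : 1 / 2 * x ^ 2 - y ≤ 0)
    (h : α * y + b * x < α * (1 / 2 * (-b / α) ^ 2) + b * (-b / α)) :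
    α < 0 ∨ (α = 0 ∧ b ≠ 0) := by
  have := pos_of_vertex_lt (α := -α) (b := -b) hxy (by
    rw [neg_neg, div_neg, ← neg_div]
    linarith)
  simpa using this

/-- With `α ≠ 0`, raising `y` above the vertex supplies any `t` with the sign of `α`; with `α = 0`,
moving `x` supplies any `t`, and the vertex is at `0` by the convention for division. -/
theorem exists_coord_add {α b t : ℝ}
    (h : 0 ≤ t * α ∧ α ≠ 0 ∨ (α = 0 ∧ b ≠ 0)) :
    ∃ x y : ℝ, 1 / 2 * x ^ 2 - y ≤ 0 ∧
      α * y + b * x = α * (1 / 2 * (-b / α) ^ 2) + b * (-b / α) + t := by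
  rcases h with ⟨h, hα⟩ | ⟨rfl, hb⟩
  · refine ⟨-b / α, 1 / 2 * (-b / α) ^ 2 + t / α, ?_, ?_⟩
    · have : 0 ≤ t / α := by
        rw [← mul_div_mul_right t α hα]
        exact div_nonneg h (mul_self_nonneg α)
      linarith
    · field_simp
      ring
  · refine ⟨t / b, 1 / 2 * (t / b) ^ 2, (sub_self _).le, ?_⟩
    field_simp
    ring

/-- A coercive separable form attains its minimum over the product of epigraphs cut by a closed
condition, some coordinates being fixed. -/
theorem exists_min_coercive {d g r s : ι → ℝ} (hd : ∀ i, 0 < d i ∨ (d i = 0 ∧ g i = 0))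
    {T : Set ((ι → ℝ) × (ι → ℝ))} (hT : IsClosed T) (hne : T.Nonempty)
    (hK : ∀ p ∈ T, AboveParabola p.1 p.2) (hfix : ∀ p ∈ T, ∀ i, d i = 0 → p.1 i = r i ∧ p.2 i = s i) :
    ∃ p ∈ T, ∀ q ∈ T, linForm d g p.1 p.2 ≤ linForm d g q.1 q.2 := by
  classical
  obtain ⟨p₀, hp₀⟩ := hne
  have hcont : Continuous fun p : (ι → ℝ) × (ι → ℝ) => linForm d g p.1 p.2 := by
    unfold linForm
    fun_prop
  let m : ι → ℝ := fun i => d i * (1 / 2 * (-g i / d i) ^ 2) + g i * (-g i / d i)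
  -- The most that coordinate `i` can contribute in the sublevel set of `p₀`: the level minus the
  -- minima of all other coordinates.
  let W : ι → ℝ := fun i => linForm d g p₀.1 p₀.2 - (∑ j, m j - m i)
  let U : ι → ℝ := fun i => if d i = 0 then s i else 2 * (W i + g i ^ 2 / d i) / d i
  have hbox : ∀ p ∈ T, linForm d g p.1 p.2 ≤ linForm d g p₀.1 p₀.2 → ∀ i, p.2 i ≤ U i := by
    intro p hp hle i
    by_cases hi : d i = 0
    · simp [U, hi, (hfix p hp i hi).2]
    · simp only [U, hi, if_false]
      refine coord_bound ((hd i).resolve_right fun h => hi h.1) (hK p hp i) ?_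
      have h1 : ∑ j, m j - m i ≤ linForm d g p.1 p.2 - (d i * p.2 i + g i * p.1 i) := by
        unfold linForm
        rw [← Finset.sum_erase_eq_sub (Finset.mem_univ i),
          ← Finset.sum_erase_eq_sub (Finset.mem_univ i)]
        exact Finset.sum_le_sum fun j _ => coord_min (hd j) (hK p hp j)
      simp only [W]
      linarith
  let box : Set ((ι → ℝ) × (ι → ℝ)) :=
    (Set.univ.pi fun i => Set.Icc (-(1 + 2 * U i)) (1 + 2 * U i)) ×ˢ
      (Set.univ.pi fun i => Set.Icc 0 (U i))
  have hboxc : IsCompact box :=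
    (isCompact_univ_pi fun _ => isCompact_Icc).prod (isCompact_univ_pi fun _ => isCompact_Icc)
  let T₀ := T ∩ {p | linForm d g p.1 p.2 ≤ linForm d g p₀.1 p₀.2}
  have hT₀ : IsCompact T₀ := by
    refine hboxc.of_isClosed_subset (hT.inter (isClosed_le hcont continuous_const)) ?_
    rintro p ⟨hp, hle⟩
    have hu := hbox p hp hle
    refine ⟨fun i _ => ?_, fun i _ => ⟨?_, hu i⟩⟩
    · have h1 := hK p hp i
      have h2 := hu i
      have h3 : p.1 i ^ 2 ≤ 2 * U i := by linarith
      constructor <;> nlinarith [sq_nonneg (p.1 i + 1), sq_nonneg (p.1 i - 1)]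
    · nlinarith [hK p hp i, sq_nonneg (p.1 i)]
  obtain ⟨p, hp, hmin⟩ := hT₀.exists_isMinOn ⟨p₀, hp₀, le_refl (linForm d g p₀.1 p₀.2)⟩ hcont.continuousOn
  refine ⟨p, hp.1, fun q hq => ?_⟩
  rcases le_total (linForm d g q.1 q.2) (linForm d g p₀.1 p₀.2) with h | h
  · exact hmin ⟨hq, h⟩
  · exact (hp.2 : linForm d g p.1 p.2 ≤ _).trans h

/-- Attainment for a linear form over the product of epigraphs cut by one linear equation. -/
theorem exists_min_of_bddBelow {α b δ e : ι → ℝ} {c B : ℝ}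
    (hfeas : ∃ x y, AboveParabola x y ∧ linForm α b x y + c = 0)
    (hB : ∀ x y, AboveParabola x y → linForm α b x y + c = 0 → B ≤ linForm δ e x y) :
    ∃ x y, (AboveParabola x y ∧ linForm α b x y + c = 0) ∧
      ∀ x' y', AboveParabola x' y' → linForm α b x' y' + c = 0 →
        linForm δ e x y ≤ linForm δ e x' y' := by
  classical
  by_cases hneg : ∃ x y, AboveParabola x y ∧ linForm α b x y + c < 0
  swap
  · push Not at hneg
    exact exists_min_of_nonneg hfeas hB hneg
  by_cases hpos : ∃ x y, AboveParabola x y ∧ 0 < linForm α b x y + c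
  swap
  · push Not at hpos
    have hflip : ∀ x y, linForm (-α) (-b) x y + -c = -(linForm α b x y + c) := by
      intro x y
      simp only [linForm, Pi.neg_apply, neg_add, ← Finset.sum_neg_distrib]
      congr 1
      exact Finset.sum_congr rfl fun i _ => by ring
    have := exists_min_of_nonneg (α := -α) (b := -b) (c := -c) (δ := δ) (e := e) (B := B)
      (by simpa only [hflip, neg_eq_zero] using hfeas)
      (by simpa only [hflip, neg_eq_zero] using hB)
      (by simpa only [hflip, neg_nonneg] using hpos)
    simpa only [hflip, neg_eq_zero] using this
  obtain ⟨μ, hμ⟩ := exists_multiplier hB hneg hpos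
  let d : ι → ℝ := fun i => δ i + μ * α i
  let g : ι → ℝ := fun i => e i + μ * b i
  have hdg : ∀ x y, linForm d g x y = linForm δ e x y + μ * linForm α b x y :=
    fun x y => linForm_add_smul δ e α b x y μ
  have hd : ∀ i, 0 < d i ∨ (d i = 0 ∧ g i = 0) :=
    coeff_of_bddBelow (B := B - μ * c) fun x y h => by
      rw [hdg]
      linarith [hμ x y h]
  -- Coordinates with `d i = 0` do not affect the Lagrangian. They are parked at the vertex of their
  -- constraint term, and the equation is relaxed to: the residual is zero or has a sign that some
  -- parked coordinate can supply.
  let r : ι → ℝ := fun i => -b i / α i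
  let s : ι → ℝ := fun i => 1 / 2 * (-b i / α i) ^ 2
  let pos : Prop := ∃ i, d i = 0 ∧ (0 < α i ∨ (α i = 0 ∧ b i ≠ 0))
  let neg : Prop := ∃ i, d i = 0 ∧ (α i < 0 ∨ (α i = 0 ∧ b i ≠ 0))
  let T : Set ((ι → ℝ) × (ι → ℝ)) := {p | (AboveParabola p.1 p.2 ∧
    (∀ i, d i = 0 → p.1 i = r i ∧ p.2 i = s i)) ∧
    -(linForm α b p.1 p.2 + c) ∈ {t : ℝ | (0 < t → pos) ∧ (t < 0 → neg)}}
  have hK : IsClosed {p : (ι → ℝ) × (ι → ℝ) | AboveParabola p.1 p.2} := by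
    have : {p : (ι → ℝ) × (ι → ℝ) | AboveParabola p.1 p.2}
        = ⋂ i, {p | 1 / 2 * p.1 i ^ 2 - p.2 i ≤ 0} := by
      ext p
      simp [AboveParabola]
    rw [this]
    exact isClosed_iInter fun i => isClosed_le (by fun_prop) continuous_const
  have hF : IsClosed {p : (ι → ℝ) × (ι → ℝ) | ∀ i, d i = 0 → p.1 i = r i ∧ p.2 i = s i} := by
    have : {p : (ι → ℝ) × (ι → ℝ) | ∀ i, d i = 0 → p.1 i = r i ∧ p.2 i = s i}
        = ⋂ i, ⋂ _ : d i = 0, {p | p.1 i = r i} ∩ {p | p.2 i = s i} := by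
      ext p
      simp
    rw [this]
    exact isClosed_iInter fun i => isClosed_iInter fun _ =>
      (isClosed_eq (by fun_prop) continuous_const).inter (isClosed_eq (by fun_prop) continuous_const)
  have hTclosed : IsClosed T :=
    (hK.inter hF).inter ((isClosed_setOf_sign pos neg).preimage (by unfold linForm; fun_prop))
  -- fixing the coordinates without curvature
  let X : (ι → ℝ) → ι → ℝ := fun x i => if d i = 0 then r i else x i
  let Y : (ι → ℝ) → ι → ℝ := fun y i => if d i = 0 then s i else y i
  have hobj : ∀ x y, linForm d g (X x) (Y y) = linForm d g x y := by
    intro x y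
    refine Finset.sum_congr rfl fun i _ => ?_
    rcases hd i with h | h
    · simp [X, Y, h.ne']
    · rw [h.1, h.2]
      simp
  have hmem : ∀ x y, AboveParabola x y → linForm α b x y + c = 0 → (X x, Y y) ∈ T := by
    intro x y h hc
    refine ⟨⟨fun i => ?_, fun i hi => by simp [X, Y, hi]⟩, ?_⟩
    · by_cases hi : d i = 0
      · simp [X, Y, hi, r, s]
      · simpa [X, Y, hi] using h i
    · have hdiff : -(linForm α b (X x) (Y y) + c)
          = ∑ i, ((α i * y i + b i * x i) - (α i * Y y i + b i * X x i)) := by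
        rw [Finset.sum_sub_distrib]
        unfold linForm at hc ⊢
        linarith
      show (0 < -(linForm α b (X x) (Y y) + c) → pos) ∧ (-(linForm α b (X x) (Y y) + c) < 0 → neg)
      rw [hdiff]
      constructor
      · intro ht
        obtain ⟨i, -, hi⟩ := Finset.exists_lt_of_sum_lt
          (f := fun _ : ι => (0 : ℝ)) (Finset.sum_const_zero.trans_lt ht)
        by_cases hdi : d i = 0
        · simp only [X, Y, hdi, if_true, r, s] at hi
          exact ⟨i, hdi, pos_of_vertex_lt (h i) (by linarith)⟩
        · simp [X, Y, hdi] at hi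
      · intro ht
        obtain ⟨i, -, hi⟩ := Finset.exists_lt_of_sum_lt
          (g := fun _ : ι => (0 : ℝ)) (ht.trans_eq Finset.sum_const_zero.symm)
        by_cases hdi : d i = 0
        · simp only [X, Y, hdi, if_true, r, s] at hi
          exact ⟨i, hdi, neg_of_lt_vertex (h i) (by linarith)⟩
        · simp [X, Y, hdi] at hi
  obtain ⟨x₀, y₀, h₀, hc₀⟩ := hfeas
  obtain ⟨⟨x, y⟩, ⟨⟨hK, hfix⟩, hpn⟩, hmin⟩ := exists_min_coercive hd hTclosed
    ⟨_, hmem x₀ y₀ h₀ hc₀⟩ (fun p hp => hp.1.1) (fun p hp => hp.1.2)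
  simp only at hK hfix hpn hmin
  -- A single parked coordinate absorbs the whole residual, leaving the Lagrangian unchanged.
  have hlift : ∃ x' y', (AboveParabola x' y' ∧ linForm α b x' y' + c = 0) ∧
      linForm d g x' y' = linForm d g x y := by
    set t := -(linForm α b x y + c) with ht
    have hone : ∀ i, d i = 0 → (0 ≤ t * α i ∧ α i ≠ 0 ∨ (α i = 0 ∧ b i ≠ 0)) →
        ∃ x' y', (AboveParabola x' y' ∧ linForm α b x' y' + c = 0) ∧
          linForm d g x' y' = linForm d g x y := by
      intro i hi hcase
      obtain ⟨x', y', hxy', heq⟩ := exists_coord_add hcase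
      obtain ⟨e1, e2⟩ := hfix i hi
      refine ⟨_, _, ⟨hK.update i hxy', ?_⟩, ?_⟩
      · rw [linForm_update, heq, e1, e2]
        simp only [r, s]
        linarith
      · rw [linForm_update]
        rcases hd i with h | h
        · exact absurd hi h.ne'
        · rw [h.1, h.2]
          simp
    rcases lt_trichotomy t 0 with h | h | h
    · obtain ⟨i, hi, hcase⟩ := hpn.2 h
      exact hone i hi (hcase.imp (fun h' => ⟨(mul_pos_of_neg_of_neg h h').le, h'.ne⟩) id)
    · exact ⟨x, y, ⟨hK, by linarith⟩, rfl⟩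
    · obtain ⟨i, hi, hcase⟩ := hpn.1 h
      exact hone i hi (hcase.imp (fun h' => ⟨(mul_pos h h').le, h'.ne'⟩) id)
  obtain ⟨x', y', ⟨h', hc'⟩, hval⟩ := hlift
  refine ⟨x', y', ⟨h', hc'⟩, fun x'' y'' h'' hc'' => ?_⟩
  have h1 := hmin _ (hmem x'' y'' h'' hc'')
  simp only [hobj] at h1
  rw [← hval, hdg, hdg] at h1
  have e1 : linForm α b x' y' = -c := by linarith
  have e2 : linForm α b x'' y'' = -c := by linarith
  rw [e1, e2] at h1
  linarith

end Separable

/-! ### The canonical form in coordinates -/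

section Canonical

variable {l k : ℕ}

theorem dotProduct_blockDiagonal_mulVec (N : Fin k → Matrix (Fin 2) (Fin 2) ℝ)
    (x : Fin 2 × Fin k → ℝ) :
    x ⬝ᵥ (Matrix.blockDiagonal N).mulVec x
      = ∑ j, ∑ r, ∑ s, x (r, j) * (N j r s * x (s, j)) := by
  simp only [dotProduct, Matrix.mulVec, Fintype.sum_prod_type, Matrix.blockDiagonal_apply]
  rw [Finset.sum_comm]
  refine Finset.sum_congr rfl fun j _ => Finset.sum_congr rfl fun r _ => ?_
  rw [Finset.mul_sum]
  refine Finset.sum_congr rfl fun s _ => ?_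
  rw [Finset.sum_eq_single j (fun j' _ hj' => by simp [hj'.symm]) (by simp)]
  simp

theorem quad_fromBlocks (δ : Fin l → ℝ) (N : Fin k → Matrix (Fin 2) (Fin 2) ℝ)
    (e x : Idx l k → ℝ) :
    quad (Matrix.fromBlocks (Matrix.diagonal δ) 0 0 (Matrix.blockDiagonal N)) e x
      = ∑ i, (δ i * (1 / 2 * x (Sum.inl i) ^ 2) + e (Sum.inl i) * x (Sum.inl i))
        + ∑ j, (1 / 2 * ∑ r, ∑ s, x (Sum.inr (r, j)) * (N j r s * x (Sum.inr (s, j)))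
          + ∑ r, e (Sum.inr (r, j)) * x (Sum.inr (r, j))) := by
  have h1 : x ⬝ᵥ (Matrix.fromBlocks (Matrix.diagonal δ) 0 0 (Matrix.blockDiagonal N)).mulVec x
      = ∑ i, x (Sum.inl i) * (δ i * x (Sum.inl i))
        + ∑ j, ∑ r, ∑ s, x (Sum.inr (r, j)) * (N j r s * x (Sum.inr (s, j))) := by
    rw [Matrix.fromBlocks_mulVec]
    have h := dotProduct_blockDiagonal_mulVec N (x ∘ Sum.inr)
    simp only [Function.comp_apply] at h
    rw [← h]
    simp [dotProduct, Fintype.sum_sum_type, Matrix.mulVec_diagonal]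
  have h2 : e ⬝ᵥ x = ∑ i, e (Sum.inl i) * x (Sum.inl i)
      + ∑ j, ∑ r, e (Sum.inr (r, j)) * x (Sum.inr (r, j)) := by
    simp only [dotProduct, Fintype.sum_sum_type, Fintype.sum_prod_type]
    rw [Finset.sum_comm]
  rw [quad, h1, h2, Finset.sum_add_distrib, Finset.sum_add_distrib, ← Finset.mul_sum]
  have h3 : ∑ i, x (Sum.inl i) * (δ i * x (Sum.inl i))
      = 2 * ∑ i, δ i * (1 / 2 * x (Sum.inl i) ^ 2) := by
    rw [Finset.mul_sum]
    exact Finset.sum_congr rfl fun i _ => by ring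
  rw [h3]
  ring

theorem quad_canonA (α : Fin l → ℝ) {b : Idx l k → ℝ}
    (hb : ∀ (r : Fin 2) (j : Fin k), b (Sum.inr (r, j)) = 0) (x : Idx l k → ℝ) :
    quad (canonA k α) b x
      = ∑ i, (α i * (1 / 2 * x (Sum.inl i) ^ 2) + b (Sum.inl i) * x (Sum.inl i))
        + ∑ j, x (Sum.inr (0, j)) * x (Sum.inr (1, j)) := by
  rw [canonA, quad_fromBlocks]
  congr 1
  refine Finset.sum_congr rfl fun j _ => ?_
  simp [Fin.sum_univ_two, antiE, hb]
  ring

theorem quad_canonD (δ : Fin l → ℝ) (ζ : Fin k → ℝ) {e : Idx l k → ℝ}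
    (he : ∀ j : Fin k, e (Sum.inr (0, j)) = 0) (x : Idx l k → ℝ) :
    quad (canonD δ ζ) e x
      = ∑ i, (δ i * (1 / 2 * x (Sum.inl i) ^ 2) + e (Sum.inl i) * x (Sum.inl i))
        + ∑ j, (ζ j * (x (Sum.inr (0, j)) * x (Sum.inr (1, j)))
          + (1 / 2 * x (Sum.inr (1, j)) ^ 2 + e (Sum.inr (1, j)) * x (Sum.inr (1, j)))) := by
  rw [canonD, quad_fromBlocks]
  congr 1
  refine Finset.sum_congr rfl fun j _ => ?_
  simp [Fin.sum_univ_two, antiE, jordan, he, Matrix.mul_apply]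
  ring

/-! ### Lifting to the reformulation and recovery -/

/-- The point of the reformulation that corresponds to `x`. -/
noncomputable def liftVar (x : Idx l k → ℝ) : Var l k :=
  (fun i => x (Sum.inl i), fun i => 1 / 2 * x (Sum.inl i) ^ 2,
    fun j => x (Sum.inr (0, j)) * x (Sum.inr (1, j)))

theorem liftVar_mem_feasEP1 (α : Fin l → ℝ) {b : Idx l k → ℝ} (c : ℝ)
    (hb : ∀ (r : Fin 2) (j : Fin k), b (Sum.inr (r, j)) = 0) (x : Idx l k → ℝ) :
    liftVar x ∈ feasEP1 α b c ↔ x ∈ feasEP (canonA k α) b c := by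
  simp [feasEP1, feasEP, quad_canonA α hb, liftVar]

/-- Completing the square in `x_{l+2j}` leaves `-½ e_{l+2j}²`, which is the origin of `const0`. The
last sum is the exact relaxation gap. -/
theorem quad_canonD_eq_objEP1 (δ : Fin l → ℝ) (ζ : Fin k → ℝ) {e : Idx l k → ℝ}
    (he : ∀ j : Fin k, e (Sum.inr (0, j)) = 0) (x : Idx l k → ℝ) :
    quad (canonD δ ζ) e x = objEP1 δ ζ e (liftVar x)
      + ∑ j, 1 / 2 * (x (Sum.inr (1, j)) + e (Sum.inr (1, j))) ^ 2 := by
  rw [quad_canonD δ ζ he, objEP1, const0, add_assoc, add_assoc]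
  congr 1
  rw [← Finset.sum_neg_distrib, ← Finset.sum_add_distrib, ← Finset.sum_add_distrib]
  exact Finset.sum_congr rfl fun j _ => by simp only [liftVar]; ring

theorem objEP1_liftVar_le (δ : Fin l → ℝ) (ζ : Fin k → ℝ) {e : Idx l k → ℝ}
    (he : ∀ j : Fin k, e (Sum.inr (0, j)) = 0) (x : Idx l k → ℝ) :
    objEP1 δ ζ e (liftVar x) ≤ quad (canonD δ ζ) e x := by
  rw [quad_canonD_eq_objEP1 δ ζ he]
  exact le_add_of_nonneg_right (Finset.sum_nonneg fun j _ => by positivity)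

theorem liftVar_recover (e : Idx l k → ℝ) {p : Var l k} (hp : ∀ i, 1 / 2 * p.1 i ^ 2 = p.2.1 i)
    {M : ℝ} (hM : 0 < M) : liftVar (recover e p M) = p := by
  refine Prod.ext rfl (Prod.ext (funext hp) (funext fun j => ?_))
  simp only [liftVar, recover, Sum.elim_inr, if_true, one_ne_zero, if_false]
  unfold recoverSnd
  split_ifs with h
  · field_simp
  · rcases eq_or_ne (e (Sum.inr (1, j))) 0 with h0 | h0
    · have : p.2.2 j = 0 := by
        by_contra hz
        exact h ⟨h0, hz⟩
      simp [this]
    · field_simp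

theorem recover_mem_feasEP {α : Fin l → ℝ} {b e : Idx l k → ℝ} {c : ℝ}
    (hb : ∀ (r : Fin 2) (j : Fin k), b (Sum.inr (r, j)) = 0) {p : Var l k}
    (hp : p ∈ feasEP1 α b c) (ht : ∀ i, 1 / 2 * p.1 i ^ 2 = p.2.1 i) {M : ℝ} (hM : 0 < M) :
    recover e p M ∈ feasEP (canonA k α) b c := by
  rw [← liftVar_mem_feasEP1 α c hb, liftVar_recover e ht hM]
  exact hp

theorem quad_recover_eq {δ : Fin l → ℝ} {ζ : Fin k → ℝ} {e : Idx l k → ℝ}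
    (he : ∀ j : Fin k, e (Sum.inr (0, j)) = 0) {p : Var l k}
    (ht : ∀ i, 1 / 2 * p.1 i ^ 2 = p.2.1 i)
    (hgood : ¬ ∃ j : Fin k, e (Sum.inr (1, j)) = 0 ∧ p.2.2 j ≠ 0) {M : ℝ} (hM : 0 < M) :
    quad (canonD δ ζ) e (recover e p M) = objEP1 δ ζ e p := by
  rw [quad_canonD_eq_objEP1 δ ζ he, liftVar_recover e ht hM, add_eq_left]
  refine Finset.sum_eq_zero fun j _ => ?_
  have hj : ¬ (e (Sum.inr (1, j)) = 0 ∧ p.2.2 j ≠ 0) := fun h => hgood ⟨j, h⟩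
  simp [recover, recoverSnd, if_neg hj]

/-- An exceptional index costs `½ M⁻² ≤ 1 / M`, any other costs nothing, and there are at most `k`
of them. -/
theorem quad_recover_le {δ : Fin l → ℝ} {ζ : Fin k → ℝ} {e : Idx l k → ℝ}
    (he : ∀ j : Fin k, e (Sum.inr (0, j)) = 0) {p : Var l k}
    (ht : ∀ i, 1 / 2 * p.1 i ^ 2 = p.2.1 i) {M : ℝ} (hM : 1 ≤ M) :
    quad (canonD δ ζ) e (recover e p M) ≤ objEP1 δ ζ e p + k / M := by
  have hM0 : 0 < M := by linarith
  rw [quad_canonD_eq_objEP1 δ ζ he, liftVar_recover e ht hM0]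
  refine add_le_add_right ?_ _
  have : ∀ j ∈ (Finset.univ : Finset (Fin k)),
      1 / 2 * (recover e p M (Sum.inr (1, j)) + e (Sum.inr (1, j))) ^ 2 ≤ 1 / M := by
    intro j _
    simp only [recover, Sum.elim_inr, one_ne_zero, if_false]
    unfold recoverSnd
    split_ifs with h
    · rw [h.1, add_zero]
      have h1 : 0 ≤ 1 / M := by positivity
      have h2 : 1 / M ≤ 1 := (div_le_one hM0).mpr hM
      nlinarith
    · simpa using hM0.le
  refine (Finset.sum_le_sum this).trans_eq ?_
  simp [div_eq_mul_inv]

theorem exists_lt_quad_recover {δ : Fin l → ℝ} {ζ : Fin k → ℝ} {e : Idx l k → ℝ}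
    (he : ∀ j : Fin k, e (Sum.inr (0, j)) = 0) {p : Var l k}
    (ht : ∀ i, 1 / 2 * p.1 i ^ 2 = p.2.1 i) {ε : ℝ} (hε : 0 < ε) :
    ∃ M₀ : ℝ, 0 < M₀ ∧ ∀ M, M₀ ≤ M →
      quad (canonD δ ζ) e (recover e p M) < objEP1 δ ζ e p + ε := by
  have hk : (0 : ℝ) ≤ k / ε := by positivity
  refine ⟨k / ε + 1, by linarith, fun M hM => ?_⟩
  have hM1 : 1 ≤ M := by linarith
  refine (quad_recover_le he ht hM1).trans_lt ?_
  have : (k : ℝ) / M < ε := by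
    rw [div_lt_iff₀ (by linarith), mul_comm, ← div_lt_iff₀ hε]
    linarith
  linarith

/-! ### Tight points and equality of the infima -/

/-- Every feasible point of the reformulation is dominated by a tight one. -/
theorem exists_tight_le {α δ : Fin l → ℝ} (ζ : Fin k → ℝ) {b : Idx l k → ℝ} (e : Idx l k → ℝ)
    {c : ℝ} {p : Var l k} (hp : p ∈ feasEP1 α b c)
    (hgood : ∀ i, ¬ (α i = 0 ∧ b (Sum.inl i) ≠ 0 ∧ δ i < 0)) :
    ∃ q ∈ feasEP1 α b c, (∀ i, 1 / 2 * q.1 i ^ 2 = q.2.1 i) ∧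
      objEP1 δ ζ e q ≤ objEP1 δ ζ e p := by
  choose x y hxy hcon hobj using fun i =>
    exists_tight_coord (e (Sum.inl i)) (hp.2 i) (hgood i)
  refine ⟨(x, y, p.2.2), ⟨?_, fun i => (sub_nonpos.mpr (hxy i).le)⟩, hxy, ?_⟩
  · rw [← hp.1]
    simp only [hcon]
  · simp only [objEP1, add_assoc]
    exact add_le_add_left (Finset.sum_le_sum fun i _ => hobj i) _

/-- If a variable enters the constraint only linearly while the objective is concave in it, then
the original problem is unbounded. -/
theorem not_boundedFromBelow_of_concave {α δ : Fin l → ℝ} {ζ : Fin k → ℝ} {b e : Idx l k → ℝ}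
    {c : ℝ} (hA : canonA k α ≠ 0)
    (hb : ∀ (r : Fin 2) (j : Fin k), b (Sum.inr (r, j)) = 0)
    (he : ∀ j : Fin k, e (Sum.inr (0, j)) = 0) {i : Fin l} (hα : α i = 0)
    (hbi : b (Sum.inl i) ≠ 0) (hδ : δ i < 0) :
    ¬ BoundedFromBelow (feasEP (canonA k α) b c) (quad (canonD δ ζ) e) := by
  rintro ⟨B, hB⟩
  by_cases hm : ∃ m, α m ≠ 0
  · obtain ⟨m, hm⟩ := hm
    have him : i ≠ m := by
      rintro rfl
      exact hm hα
    -- Setting `x_m = s` and solving the equation for `x_i`, with all other variables zero, gives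
    -- these coefficients.
    refine quartic_not_bddBelow hδ (a := -α m / (2 * b (Sum.inl i)))
      (div_ne_zero (neg_ne_zero.mpr hm) (mul_ne_zero two_ne_zero hbi))
      (-b (Sum.inl m) / b (Sum.inl i)) (-c / b (Sum.inl i)) (e (Sum.inl i)) (1 / 2 * δ m)
      (e (Sum.inl m)) 0 B fun s => ?_
    set t := -α m / (2 * b (Sum.inl i)) * s ^ 2 + -b (Sum.inl m) / b (Sum.inl i) * s
      + -c / b (Sum.inl i) with ht
    have htb : b (Sum.inl i) * t + (α m * (1 / 2 * s ^ 2) + b (Sum.inl m) * s) + c = 0 := by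
      rw [ht]
      field_simp
      ring
    let x : Idx l k → ℝ := Sum.elim (Function.update (Pi.single i t) m s) 0
    have hsum : ∀ (d : Fin l → ℝ) (g : Idx l k → ℝ),
        ∑ i', (d i' * (1 / 2 * x (Sum.inl i') ^ 2) + g (Sum.inl i') * x (Sum.inl i'))
        = (d i * (1 / 2 * t ^ 2) + g (Sum.inl i) * t)
          + (d m * (1 / 2 * s ^ 2) + g (Sum.inl m) * s) := by
      intro d g
      rw [Fintype.sum_eq_add i m him]
      · simp [x, him]
      · rintro j ⟨hji, hjm⟩
        simp [x, hji, hjm]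
    have hx : x ∈ feasEP (canonA k α) b c := by
      show quad _ _ _ + c = 0
      rw [quad_canonA α hb, hsum, hα]
      simp only [x, Sum.elim_inr, Pi.zero_apply, mul_zero, Finset.sum_const_zero]
      linarith
    have := hB x hx
    rw [quad_canonD δ ζ he, hsum] at this
    simp only [x, Sum.elim_inr, Pi.zero_apply] at this
    simp only [mul_zero, Finset.sum_const_zero, ne_eq, OfNat.ofNat_ne_zero, not_false_eq_true,
      zero_pow, add_zero] at this
    linarith
  · push Not at hm
    have hk : Nonempty (Fin k) := by
      by_contra hk
      rw [not_nonempty_iff] at hk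
      refine hA ?_
      have : α = 0 := funext hm
      ext a a'
      rcases a with a | ⟨-, j⟩
      · rcases a' with a' | ⟨-, j⟩
        · simp [canonA, this]
        · exact hk.elim j
      · exact hk.elim j
    obtain ⟨j⟩ := hk
    -- The block variables `(s², 1)` have product `s²`, which takes the role of the quadratic term
    -- in the equation.
    refine quartic_not_bddBelow hδ (a := -1 / b (Sum.inl i))
      (div_ne_zero (neg_ne_zero.mpr one_ne_zero) hbi) 0 (-c / b (Sum.inl i)) (e (Sum.inl i)) (ζ j) 0
      (1 / 2 + e (Sum.inr (1, j))) B fun s => ?_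
    set t := -1 / b (Sum.inl i) * s ^ 2 + 0 * s + -c / b (Sum.inl i) with ht
    have htb : b (Sum.inl i) * t + s ^ 2 + c = 0 := by
      rw [ht]
      field_simp
      ring
    let x : Idx l k → ℝ := Sum.elim (Pi.single i t)
      fun rj => if rj.2 = j then (if rj.1 = 0 then s ^ 2 else 1) else 0
    have hsum : ∀ (d : Fin l → ℝ) (g : Idx l k → ℝ),
        ∑ i', (d i' * (1 / 2 * x (Sum.inl i') ^ 2) + g (Sum.inl i') * x (Sum.inl i'))
        = d i * (1 / 2 * t ^ 2) + g (Sum.inl i) * t := by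
      intro d g
      rw [Fintype.sum_eq_single i]
      · simp [x]
      · intro j hji
        simp [x, hji]
    have hx : x ∈ feasEP (canonA k α) b c := by
      show quad _ _ _ + c = 0
      rw [quad_canonA α hb, hsum, hα,
        Fintype.sum_eq_single j fun j' hj' => by simp [x, hj']]
      simp [x]
      linarith
    have := hB x hx
    rw [quad_canonD δ ζ he, hsum, Fintype.sum_eq_single j fun j' hj' => by simp [x, hj']] at this
    simp [x] at this
    linarith

/-- The reformulation has every lower bound that the original problem has. -/
theorem le_objEP1_of_forall_le_quad {α δ : Fin l → ℝ} {ζ : Fin k → ℝ} {b e : Idx l k → ℝ}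
    {c : ℝ} (hA : canonA k α ≠ 0)
    (hb : ∀ (r : Fin 2) (j : Fin k), b (Sum.inr (r, j)) = 0)
    (he : ∀ j : Fin k, e (Sum.inr (0, j)) = 0) {m : ℝ}
    (hm : ∀ x ∈ feasEP (canonA k α) b c, m ≤ quad (canonD δ ζ) e x) {p : Var l k}
    (hp : p ∈ feasEP1 α b c) : m ≤ objEP1 δ ζ e p := by
  obtain ⟨q, hq, ht, hle⟩ := exists_tight_le (δ := δ) ζ e hp fun i ⟨h1, h2, h3⟩ =>
    not_boundedFromBelow_of_concave hA hb he h1 h2 h3 ⟨m, hm⟩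
  refine le_trans (le_of_forall_pos_le_add fun ε hε => ?_) hle
  obtain ⟨M, hM0, hM⟩ := exists_lt_quad_recover (δ := δ) (ζ := ζ) he ht hε
  exact (hm _ (recover_mem_feasEP hb hq ht hM0)).trans (hM M le_rfl).le

theorem optVal_feasEP_eq {α δ : Fin l → ℝ} {ζ : Fin k → ℝ} {b e : Idx l k → ℝ}
    {c : ℝ} (hA : canonA k α ≠ 0)
    (hb : ∀ (r : Fin 2) (j : Fin k), b (Sum.inr (r, j)) = 0)
    (he : ∀ j : Fin k, e (Sum.inr (0, j)) = 0) :
    optVal (feasEP (canonA k α) b c) (quad (canonD δ ζ) e)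
      = optVal (feasEP1 α b c) (objEP1 δ ζ e) := by
  apply le_antisymm
  · refine le_iInf₂ fun p hp => ?_
    by_contra! hlt
    -- A real `m` in between is a lower bound for the original problem; this covers infinite optimal
    -- values too.
    obtain ⟨m, h1, h2⟩ := EReal.lt_iff_exists_real_btwn.mp hlt
    refine absurd (EReal.coe_lt_coe_iff.mp h1) (not_lt.mpr ?_)
    refine le_objEP1_of_forall_le_quad hA hb he (fun x hx => ?_) hp
    exact EReal.coe_le_coe_iff.mp (h2.le.trans (iInf₂_le x hx))
  · refine le_iInf₂ fun x hx => ?_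
    exact (iInf₂_le (liftVar x) ((liftVar_mem_feasEP1 α c hb x).mpr hx)).trans
      (EReal.coe_le_coe_iff.mpr (objEP1_liftVar_le δ ζ he x))

theorem optVal_eq_of_isOptimal {V : Type*} {X : Set V} {f : V → ℝ} {x : V}
    (h : IsOptimal X f x) : optVal X f = (f x : EReal) :=
  le_antisymm (iInf₂_le x h.1) (le_iInf₂ fun x' hx' => EReal.coe_le_coe_iff.mpr (h.2 x' hx'))

/-- Shifting `t` from `z_j` to `z_i` keeps `∑ z` and changes the objective by `(ζ i - ζ j) t`; the
chosen `t` reaches `B - 1`. -/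
theorem forall_zeta_eq_of_bddBelow {α δ : Fin l → ℝ} {ζ : Fin k → ℝ} {b e : Idx l k → ℝ}
    {c : ℝ} (hne : (feasEP1 α b c).Nonempty)
    (hbdd : BoundedFromBelow (feasEP1 α b c) (objEP1 δ ζ e)) (i j : Fin k) : ζ i = ζ j := by
  by_contra hij
  obtain ⟨p, hp⟩ := hne
  obtain ⟨B, hB⟩ := hbdd
  set t := (B - 1 - objEP1 δ ζ e p) / (ζ i - ζ j) with ht
  have h1 : (ζ i - ζ j) * t = B - 1 - objEP1 δ ζ e p := mul_div_cancel₀ _ (sub_ne_zero.mpr hij)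
  let z : Fin k → ℝ := p.2.2 + (Pi.single i t - Pi.single j t)
  have hz : ∀ w : Fin k → ℝ, ∑ a, w a * z a = ∑ a, w a * p.2.2 a + (w i - w j) * t := by
    intro w
    simp only [z, Pi.add_apply, Pi.sub_apply, mul_add, mul_sub, Finset.sum_add_distrib,
      Finset.sum_sub_distrib, Pi.single_apply, mul_ite, mul_zero, Finset.sum_ite_eq',
      Finset.mem_univ, if_true]
    ring
  have hz1 : ∑ a, z a = ∑ a, p.2.2 a := by simpa using hz 1
  have h2 := hB (p.1, p.2.1, z) ⟨by simpa only [hz1] using hp.1, hp.2⟩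
  simp only [objEP1, hz] at h2 h1
  linarith

/-- For `k = 0` this is `exists_min_of_bddBelow`. For `k > 0` the common value of `ζ` acts as the
multiplier: the equation only fixes `∑ z`, and substituting it leaves a separable form minimized
coordinatewise. -/
theorem exists_isOptimal_feasEP1 {α δ : Fin l → ℝ} {ζ : Fin k → ℝ} {b e : Idx l k → ℝ}
    {c : ℝ} (hne : (feasEP1 α b c).Nonempty)
    (hbdd : BoundedFromBelow (feasEP1 α b c) (objEP1 δ ζ e)) :
    ∃ p, IsOptimal (feasEP1 α b c) (objEP1 δ ζ e) p := by
  rcases isEmpty_or_nonempty (Fin k) with hk | ⟨⟨j⟩⟩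
  · obtain ⟨B, hB⟩ := hbdd
    have hmem : ∀ p : Var l k, p ∈ feasEP1 α b c ↔ AboveParabola p.1 p.2.1 ∧
        linForm α (fun i => b (Sum.inl i)) p.1 p.2.1 + c = 0 := by
      intro p
      rw [and_comm]
      simp [feasEP1, AboveParabola, linForm]
    have hobj : ∀ p : Var l k,
        objEP1 δ ζ e p = linForm δ (fun i => e (Sum.inl i)) p.1 p.2.1 + const0 e := by
      intro p
      simp [objEP1, linForm]
    obtain ⟨p, hp⟩ := hne
    obtain ⟨x, y, hxy, hmin⟩ := exists_min_of_bddBelow (α := α) (b := fun i => b (Sum.inl i))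
      (δ := δ) (e := fun i => e (Sum.inl i)) (c := c) (B := B - const0 e)
      ⟨p.1, p.2.1, (hmem p).mp hp⟩ fun x y h hc => by
        have := hB (x, y, 0) ((hmem _).mpr ⟨h, hc⟩)
        rw [hobj] at this
        linarith
    refine ⟨(x, y, 0), (hmem _).mpr hxy, fun q hq => ?_⟩
    rw [hobj, hobj]
    have := hmin q.1 q.2.1 ((hmem q).mp hq).1 ((hmem q).mp hq).2
    linarith
  · have hζ : ∀ i, ζ i = ζ j := fun i => forall_zeta_eq_of_bddBelow hne hbdd i j
    obtain ⟨B, hB⟩ := hbdd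
    let d : Fin l → ℝ := fun i => δ i + -ζ j * α i
    let g : Fin l → ℝ := fun i => e (Sum.inl i) + -ζ j * b (Sum.inl i)
    have hdg : ∀ x y, linForm d g x y = linForm δ (fun i => e (Sum.inl i)) x y
        + -ζ j * linForm α (fun i => b (Sum.inl i)) x y :=
      fun x y => linForm_add_smul δ (fun i => e (Sum.inl i)) α (fun i => b (Sum.inl i)) x y (-ζ j)
    have hobj : ∀ p ∈ feasEP1 α b c,
        objEP1 δ ζ e p = linForm d g p.1 p.2.1 + (const0 e - ζ j * c) := by
      intro p hp
      have h1 : ∑ i, p.2.2 i = -(linForm α (fun i => b (Sum.inl i)) p.1 p.2.1 + c) := by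
        have := hp.1
        unfold linForm
        linarith
      rw [hdg, objEP1]
      simp only [hζ]
      rw [← Finset.mul_sum, h1]
      unfold linForm
      ring
    have hext : ∀ x y, AboveParabola x y → ∃ z : Fin k → ℝ, (x, y, z) ∈ feasEP1 α b c :=
      fun x y h => ⟨Pi.single j (-(linForm α (fun i => b (Sum.inl i)) x y + c)),
        by simp [linForm], h⟩
    obtain ⟨x, y, h, hmin⟩ := exists_min_linForm (d := d) (g := g)
      (B := B - (const0 e - ζ j * c)) fun x y h => by
        obtain ⟨z, hz⟩ := hext x y h
        have := hB _ hz
        rw [hobj _ hz] at this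
        linarith
    obtain ⟨z, hz⟩ := hext x y h
    refine ⟨(x, y, z), hz, fun q hq => ?_⟩
    rw [hobj _ hz, hobj _ hq]
    have := hmin q.1 q.2.1 hq.2
    linarith

theorem exists_isTightOptimal {α δ : Fin l → ℝ} {ζ : Fin k → ℝ} {b e : Idx l k → ℝ}
    {c : ℝ} (h : ∃ p, IsOptimal (feasEP1 α b c) (objEP1 δ ζ e) p) :
    ∃ p, IsTightOptimal α δ ζ b e c p := by
  obtain ⟨p, hp, hmin⟩ := h
  obtain ⟨q, hq, ht, hle⟩ := exists_tight_le (δ := δ) ζ e hp fun i ⟨h1, h2, h3⟩ => by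
    -- If `α i = 0` and `δ i < 0`, raising `y_i` by one stays feasible and lowers the objective,
    -- against optimality.
    have hfeas : (p.1, p.2.1 + Pi.single i 1, p.2.2) ∈ feasEP1 α b c := by
      refine ⟨?_, fun i' => ?_⟩
      · rw [← hp.1]
        simp [mul_add, Finset.sum_add_distrib, Pi.single_apply, h1]
      · have h4 := hp.2 i'
        have h5 : (0 : ℝ) ≤ (Pi.single i 1 : Fin l → ℝ) i' := by
          rw [Pi.single_apply]
          split_ifs <;> norm_num
        simp only [Pi.add_apply]
        linarith
    have h4 := hmin _ hfeas
    have h5 : objEP1 δ ζ e (p.1, p.2.1 + Pi.single i 1, p.2.2) = objEP1 δ ζ e p + δ i := by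
      simp [objEP1, mul_add, Finset.sum_add_distrib, Pi.single_apply]
      ring
    linarith
  exact ⟨q, ⟨hq, fun x' hx' => hle.trans (hmin x' hx')⟩, ht⟩

/-- An optimal solution of the original problem yields a tight optimal solution of the
reformulation. -/
theorem isTightOptimal_liftVar {α δ : Fin l → ℝ} {ζ : Fin k → ℝ} {b e : Idx l k → ℝ}
    {c : ℝ} (hA : canonA k α ≠ 0)
    (hb : ∀ (r : Fin 2) (j : Fin k), b (Sum.inr (r, j)) = 0)
    (he : ∀ j : Fin k, e (Sum.inr (0, j)) = 0) {x : Idx l k → ℝ}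
    (hx : IsOptimal (feasEP (canonA k α) b c) (quad (canonD δ ζ) e) x) :
    IsTightOptimal α δ ζ b e c (liftVar x) ∧
      ¬ ∃ j : Fin k, e (Sum.inr (1, j)) = 0 ∧ (liftVar x).2.2 j ≠ 0 := by
  have hmem := (liftVar_mem_feasEP1 α c hb x).mpr hx.1
  refine ⟨⟨⟨hmem, fun q hq => ?_⟩, fun i => rfl⟩, ?_⟩
  · exact (objEP1_liftVar_le δ ζ he x).trans (le_objEP1_of_forall_le_quad hA hb he hx.2 hq)
  · rintro ⟨j, hej, hzj⟩
    have h1 := le_objEP1_of_forall_le_quad hA hb he hx.2 hmem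
    rw [quad_canonD_eq_objEP1 δ ζ he] at h1
    -- Optimality forces a zero gap, so `x_{l+2j} = -e_{l+2j} = 0` and the product `z_j` vanishes.
    have h2 : ∑ j, 1 / 2 * (x (Sum.inr (1, j)) + e (Sum.inr (1, j))) ^ 2 = 0 :=
      le_antisymm (by linarith) (Finset.sum_nonneg fun j _ => by positivity)
    have h3 := (Finset.sum_eq_zero_iff_of_nonneg fun j _ => by positivity).mp h2 j
      (Finset.mem_univ j)
    rw [hej] at h3
    have h4 : x (Sum.inr (1, j)) = 0 := by simpa using h3
    exact hzj (by simp [liftVar, h4])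

theorem isOptimal_recover {α δ : Fin l → ℝ} {ζ : Fin k → ℝ} {b e : Idx l k → ℝ} {c : ℝ}
    (hb : ∀ (r : Fin 2) (j : Fin k), b (Sum.inr (r, j)) = 0)
    (he : ∀ j : Fin k, e (Sum.inr (0, j)) = 0) {p : Var l k}
    (hp : IsTightOptimal α δ ζ b e c p)
    (hgood : ¬ ∃ j : Fin k, e (Sum.inr (1, j)) = 0 ∧ p.2.2 j ≠ 0) {M : ℝ} (hM : 0 < M) :
    IsOptimal (feasEP (canonA k α) b c) (quad (canonD δ ζ) e) (recover e p M) := by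
  refine ⟨recover_mem_feasEP hb hp.1.1 hp.2 hM, fun x hx => ?_⟩
  rw [quad_recover_eq he hp.2 hgood hM]
  exact (hp.1.2 _ ((liftVar_mem_feasEP1 α c hb x).mpr hx)).trans (objEP1_liftVar_le δ ζ he x)

end Canonical

end GTRS

open GTRS
theorem theorem3p3 (l k : ℕ) (α δ : Fin l → ℝ) (ζ : Fin k → ℝ) (b e : Idx l k → ℝ) (c : ℝ)
    (hA : ConstraintAssumption (canonA k α) b c)
    (hb : ∀ (r : Fin 2) (j : Fin k), b (Sum.inr (r, j)) = 0)
    (he : ∀ j : Fin k, e (Sum.inr (0, j)) = 0) :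
    -- the two problems have the same optimal value (possibly `-∞`)
    optVal (feasEP (canonA k α) b c) (quad (canonD δ ζ) e)
        = optVal (feasEP1 α b c) (objEP1 δ ζ e) ∧
    -- an optimal solution of the reformulation can be taken tight
    ((∃ p, IsOptimal (feasEP1 α b c) (objEP1 δ ζ e) p) →
      ∃ p, IsTightOptimal α δ ζ b e c p) ∧
    -- in the bounded case the reformulation does have an optimal solution
    (BoundedFromBelow (feasEP (canonA k α) b c) (quad (canonD δ ζ) e) →
      ∃ p, IsOptimal (feasEP1 α b c) (objEP1 δ ζ e) p) ∧
    -- recovery of an optimal or of an `ε`-optimal solution from any tight optimal solution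
    (∀ p, IsTightOptimal α δ ζ b e c p →
      ((¬ ∃ j : Fin k, e (Sum.inr (1, j)) = 0 ∧ p.2.2 j ≠ 0) → ∀ M : ℝ, 0 < M →
        IsOptimal (feasEP (canonA k α) b c) (quad (canonD δ ζ) e) (recover e p M)) ∧
      ∀ ε : ℝ, 0 < ε → ∃ M₀ : ℝ, 0 < M₀ ∧ ∀ M : ℝ, M₀ ≤ M →
        recover e p M ∈ feasEP (canonA k α) b c ∧
        ((quad (canonD δ ζ) e (recover e p M) : ℝ) : EReal)
          < optVal (feasEP (canonA k α) b c) (quad (canonD δ ζ) e) + ((ε : ℝ) : EReal)) ∧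
    -- characterization of unattainability
    (BoundedFromBelow (feasEP (canonA k α) b c) (quad (canonD δ ζ) e) →
      ((¬ ∃ x, IsOptimal (feasEP (canonA k α) b c) (quad (canonD δ ζ) e) x) ↔
        ∀ p, IsTightOptimal α δ ζ b e c p →
          ∃ j : Fin k, e (Sum.inr (1, j)) = 0 ∧ p.2.2 j ≠ 0)) ∧
    -- different eigenvalues
    ((∃ i j : Fin k, ζ i ≠ ζ j) →
      ¬ BoundedFromBelow (feasEP (canonA k α) b c) (quad (canonD δ ζ) e)) := by
  have hA0 := hA.ne_zero
  have hbdd : BoundedFromBelow (feasEP (canonA k α) b c) (quad (canonD δ ζ) e) →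
      BoundedFromBelow (feasEP1 α b c) (objEP1 δ ζ e) := fun ⟨m, hm⟩ =>
    ⟨m, fun _ hp => le_objEP1_of_forall_le_quad hA0 hb he hm hp⟩
  have hne : (feasEP1 α b c).Nonempty := by
    obtain ⟨x, hx⟩ := hA.feasible
    exact ⟨_, (liftVar_mem_feasEP1 α c hb x).mpr hx⟩
  refine ⟨optVal_feasEP_eq hA0 hb he, exists_isTightOptimal,
    fun h => exists_isOptimal_feasEP1 hne (hbdd h),
    fun p hp => ⟨fun hgood M hM => isOptimal_recover hb he hp hgood hM, fun ε hε => ?_⟩,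
    fun h => ⟨fun hno p hp => ?_, ?_⟩, ?_⟩
  · obtain ⟨M₀, hM₀, hM⟩ := exists_lt_quad_recover (δ := δ) (ζ := ζ) he hp.2 hε
    refine ⟨M₀, hM₀, fun M hMM => ⟨recover_mem_feasEP hb hp.1.1 hp.2 (hM₀.trans_le hMM), ?_⟩⟩
    rw [optVal_feasEP_eq hA0 hb he, optVal_eq_of_isOptimal hp.1]
    exact_mod_cast hM M hMM
  · by_contra hgood
    exact hno ⟨_, isOptimal_recover hb he hp hgood one_pos⟩
  · rintro hall ⟨x, hx⟩
    obtain ⟨h1, h2⟩ := isTightOptimal_liftVar hA0 hb he hx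
    exact h2 (hall _ h1)
  · rintro ⟨i, j, hij⟩ h
    exact hij (forall_zeta_eq_of_bddBelow hne (hbdd h) i j)
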